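/- A dynamic network on a system $V=\{1,\dots,n\}$ of $n$ processes is a sequence $\mathcal G=(E_t)_{t\ge 1}$, where $E_t$ is a finite multiset of unordered pairs of elements of $V$ (the links at round $t$). It is $T$-interval-disconnected if for every $i\ge 1$ the multigraph $(V, E_i\cup E_{i+1}\cup\dots\cup E_{i+T-1})$ is connected. Each process has an input in $\{\text{leader},\text{non-leader}\}\times X$, where $X$ is an arbitrary set; let $\lambda$ be the assignment of inputs. A (deterministic, anonymous) algorithm consists of a set of states partitioned into terminal and non-terminal ones, a map from inputs to initial states, a map from terminal states to outputs, and a transition function $\mathcal A$ from pairs (non-terminal state, finite multiset of states) to states. At each round $t\geq 1$ every process $p$ receives the multiset of the current states of its neighbors, one copy per incident link in $E_t$; if its own state $\sigma$ is non-terminal and it has received $M$, its new state is $\mathcal A(\sigma,M)$; a terminal state never changes. The execution terminates in at most $k$ rounds if at the end of some round $t\le k$ (with $t=0$ referring to the initial states) all processes are in terminal states; their outputs are then the outputs associated with these states. Theorem. Let $\ell\ge 1$ and $T\ge 1$ be integers. There is an algorithm (which may depend on $\ell$ and $T$, but does not depend on $n$) such that, for every $n$, every $T$-interval-disconnected dynamic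 network with $n$ processes, and every assignment $\lambda$ of inputs with exactly $\ell$ leaders, the execution terminates in at most $(\ell^2+\ell+1)Tn$ rounds and every process outputs $F_{GC}(\lambda)=\mu_\lambda$, the multiset of the inputs (leader flags included) of all $n$ processes. -/

import Mathlib

universe u

/-- A multigraph on `V`: a multiset of unordered pairs of elements of `V`, given by its
multiplicity function. Parallel links are allowed, and so are loops. -/
abbrev Multigraph (V : Type) := Sym2 V → ℕ

/-- The simple graph that underlies a multigraph: two distinct vertices are adjacent when at
least one link joins them. -/
def Multigraph.toSimpleGraph {V : Type} (E : Multigraph V) : SimpleGraph V where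
  Adj p q := p ≠ q ∧ 0 < E s(p, q)
  symm := ⟨fun p q h => ⟨h.1.symm, by rw [Sym2.eq_swap]; exact h.2⟩⟩
  loopless := ⟨fun _ h => h.1 rfl⟩

/-- A multigraph is connected when any two of its vertices are joined by a path of links. -/
def Multigraph.IsConnected {V : Type} (E : Multigraph V) : Prop :=
  E.toSimpleGraph.Connected

/-- A dynamic network on the system `V`: `G t` is the multiset of links at round `t`, for
`t ≥ 1`. The value `G 0` is never used. -/
abbrev DynamicNetwork (V : Type) := ℕ → Multigraph V

/-- For all `i ≥ 1`, the sum of the `T` consecutive multigraphs of the rounds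
`i, i + 1, …, i + T - 1` is connected. -/
def DynamicNetwork.IsIntervalDisconnected {V : Type} (G : DynamicNetwork V) (T : ℕ) : Prop :=
  ∀ i : ℕ, 1 ≤ i →
    Multigraph.IsConnected (V := V) (fun e => ∑ t ∈ Finset.Ico i (i + T), G t e)

/-- The computation parameters of a deterministic anonymous algorithm with inputs in `I` and
outputs in `O`: a set of states, split into terminal and non-terminal ones, an input map, an
output map on the terminal states, and a local transition function, which gets the present
non-terminal state of a process and the multiset of the states it has just received. Neither
the identity of a process nor the size of the system is available to it. -/
structure LocalAlgorithm (I O : Type u) where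
  /-- the internal states of a process -/
  State : Type u
  /-- the terminal states -/
  terminal : Set State
  /-- the initial state of a process with a given input -/
  init : I → State
  /-- the output of a process in a terminal state -/
  output : {s : State // s ∈ terminal} → O
  /-- the local computation in one round -/
  step : {s : State // s ∉ terminal} → Multiset State → State

namespace LocalAlgorithm

variable {I O : Type u} (A : LocalAlgorithm I O)

/-- The multiset of states that process `p` receives through the links `E` when the present
states are `σ`: the state of `q` comes once along each link between `p` and `q`. -/
def received {V : Type} [Fintype V] (E : Multigraph V) (σ : V → A.State) (p : V) :
    Multiset A.State :=
  ∑ q : V, E s(p, q) • ({σ q} : Multiset A.State)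

open Classical in
/-- The new state of a process in state `s` that has received the multiset `M`. A process in a
terminal state never changes its state again. -/
noncomputable def update (s : A.State) (M : Multiset A.State) : A.State :=
  if h : s ∈ A.terminal then s else A.step ⟨s, h⟩ M

/-- The state of each process at the end of round `t` (for `t = 0`, its initial state), when all
processes run `A` on the dynamic network `G` with the input assignment `inp`. -/
noncomputable def run {V : Type} [Fintype V] (G : DynamicNetwork V) (inp : V → I) :
    ℕ → V → A.State
  | 0, p => A.init (inp p)
  | t + 1, p => A.update (run G inp t p) (A.received (G (t + 1)) (run G inp t) p)

/-- The execution terminates in at most `k` rounds, with output `out p` at each process `p`: at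
the end of some round `t ≤ k` all processes are in a terminal state, with these outputs. -/
def TerminatesWithin {V : Type} [Fintype V] (G : DynamicNetwork V) (inp : V → I) (k : ℕ)
    (out : V → O) : Prop :=
  ∃ t ≤ k, ∃ h : ∀ p, A.run G inp t p ∈ A.terminal, ∀ p, A.output ⟨A.run G inp t p, h p⟩ = out p

end LocalAlgorithm

/-- The number of leaders. An input is a pair of a leader flag (`true` for a leader) and a
further input. -/
def numLeaders {V X : Type*} [Fintype V] (inp : V → Bool × X) : ℕ :=
  (Finset.univ.filter fun p => (inp p).1 = true).card

/-- The Generalized Counting function: every process has to output the multiset of the inputs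
(including leader flags) of all processes. -/
def generalizedCounting {V I : Type*} [Fintype V] (inp : V → I) : V → Multiset I :=
  fun _ => Finset.univ.val.map inp

/-! Merging each block of `T` rounds into one round gives a network that is connected in every
round, so it suffices to show that full-information views in such a network determine the inputs
after `3 * n` rounds. This yields the bound `3 * T * n`, which is at most the stated one since `ℓ ≥
1`.

Suppose that networks `H` (with `n` processes) and `H'` have equally many leaders and share a view
after `3 * n` rounds. By connectivity, all views of `H` up to round `2 * n` occur in `H'`
(`classes_subset_of_view_mem`). Two quantities never decrease and stay at most `n` there: the number
of classes of `H`, and `excess`, the sum over these classes of `a + 1 - a'` (truncated), where `a`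
and `a'` are the class sizes in `H` and `H'`. In a round where neither grows, counting the links
between two classes from both sides gives balance equations that propagate `a' ≤ a`, and then `a ≤
a'` from the leaders, through the connected networks, so the inputs agree
(`excess_lt_succ_or_map_eq`). If the inputs differ, the sum thus gains at least one per round and
exceeds `2 * n` at round `2 * n`, a contradiction (`map_eq_of_view_eq`).

The algorithm outputs `μ` once some network with at most a third as many processes as elapsed blocks
explains its view with inputs `μ`. -/

/-- A set of vertices of a connected multigraph that is nonempty and closed under links contains
every vertex. -/
theorem Multigraph.IsConnected.forall_of_closed {V : Type} {E : Multigraph V}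
    (hE : E.IsConnected) {S : V → Prop} {p : V} (hp : S p)
    (hS : ∀ p q, S p → 0 < E s(p, q) → S q) (q : V) : S q := by
  obtain ⟨w⟩ := hE.preconnected p q
  induction w with
  | nil => exact hp
  | cons h _ ih => exact ih (hS _ _ hp h.2)

/-! ### Views in full-information exchange -/

/-- The possible views of a process after `t` rounds of full-information exchange. -/
def View (I : Type u) : ℕ → Type u
  | 0 => I
  | t + 1 => View I t × Multiset (View I t)

namespace View

variable {I : Type u}

/-- The view one round earlier. -/
def prev {t : ℕ} (x : View I (t + 1)) : View I t := Prod.fst (α := View I t) x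

/-- The views received in the last round. -/
def heard {t : ℕ} (x : View I (t + 1)) : Multiset (View I t) :=
  Prod.snd (α := View I t) x

/-- The input of the process that has a given view. -/
def root : {t : ℕ} → View I t → I
  | 0, x => x
  | _ + 1, x => root x.prev

end View

/-! ### Class sizes and link counts -/

section Network

open scoped Classical

variable {I : Type u} {V V' : Type} [Fintype V] [Fintype V']

/-- The view of each process after `t` rounds, when `H t` holds the links of round `t + 1`. -/
def view (H : ℕ → Multigraph V) (inp : V → I) : (t : ℕ) → V → View I t
  | 0, p => inp p
  | t + 1, p => (view H inp t p, ∑ q : V, H t s(p, q) • ({view H inp t q} : Multiset _))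

/-- The number of processes with a given view. -/
noncomputable def anonymity (H : ℕ → Multigraph V) (inp : V → I) (t : ℕ) (x : View I t) : ℕ :=
  (Finset.univ.filter fun p => view H inp t p = x).card

/-- The set of the views that occur after `t` rounds. -/
noncomputable def classes (H : ℕ → Multigraph V) (inp : V → I) (t : ℕ) : Finset (View I t) :=
  Finset.univ.image (view H inp t)

/-- The number of links of round `t + 1` between processes with view `x` and processes with
view `y`. -/
noncomputable def linkCount (H : ℕ → Multigraph V) (inp : V → I) (t : ℕ) (x y : View I t) : ℕ :=
  ∑ p with view H inp t p = x, ∑ q with view H inp t q = y, H t s(p, q)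

variable (H : ℕ → Multigraph V) (inp : V → I) (H' : ℕ → Multigraph V') (inp' : V' → I)

@[simp] theorem prev_view (t : ℕ) (p : V) : (view H inp (t + 1) p).prev = view H inp t p := rfl

theorem heard_view (t : ℕ) (p : V) :
    (view H inp (t + 1) p).heard = ∑ q : V, H t s(p, q) • ({view H inp t q} : Multiset _) := rfl

theorem root_view (t : ℕ) (p : V) : (view H inp t p).root = inp p := by
  induction t with
  | zero => rfl
  | succ t ih => exact ih

theorem mem_classes {t : ℕ} {x : View I t} : x ∈ classes H inp t ↔ ∃ p, view H inp t p = x := by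
  simp [classes]

theorem view_mem_classes (t : ℕ) (p : V) : view H inp t p ∈ classes H inp t :=
  (mem_classes H inp).2 ⟨p, rfl⟩

theorem count_map_view (t : ℕ) (x : View I t) :
    (Finset.univ.val.map (view H inp t)).count x = anonymity H inp t x := by
  rw [Multiset.count_map, anonymity, Finset.card_def, Finset.filter_val]
  simp only [eq_comm]

theorem anonymity_pos {t : ℕ} {x : View I t} (p : V) (hp : view H inp t p = x) :
    0 < anonymity H inp t x :=
  Finset.card_pos.2 ⟨p, by simp [hp]⟩

theorem sum_anonymity (t : ℕ) : ∑ x ∈ classes H inp t, anonymity H inp t x = Fintype.card V :=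
  (Finset.card_eq_sum_card_image (view H inp t) Finset.univ).symm

theorem count_heard_view (t : ℕ) (p : V) (y : View I t) :
    (view H inp (t + 1) p).heard.count y = ∑ q with view H inp t q = y, H t s(p, q) := by
  rw [heard_view, Multiset.count_sum', Finset.sum_filter]
  refine Finset.sum_congr rfl fun q _ => ?_
  rw [Multiset.count_nsmul, Multiset.count_singleton]
  simp only [eq_comm]
  split_ifs <;> simp

theorem mem_heard_view {t : ℕ} {p : V} {y : View I t} :
    y ∈ (view H inp (t + 1) p).heard ↔ ∃ q, view H inp t q = y ∧ 0 < H t s(p, q) := by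
  rw [← Multiset.count_pos, count_heard_view, Nat.pos_iff_ne_zero, Ne, Finset.sum_eq_zero_iff]
  simp [Nat.pos_iff_ne_zero]

theorem linkCount_comm (t : ℕ) (x y : View I t) :
    linkCount H inp t x y = linkCount H inp t y x := by
  rw [linkCount, Finset.sum_comm]
  simp only [linkCount, Sym2.eq_swap]

theorem linkCount_eq_sum_count (t : ℕ) (x y : View I t) :
    linkCount H inp t x y =
      ∑ p with view H inp t p = x, (view H inp (t + 1) p).heard.count y := by
  simp only [linkCount, count_heard_view]

theorem anonymity_prev_filter {t : ℕ} (z : View I (t + 1)) :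
    (Finset.univ.filter fun p => view H inp (t + 1) p = z) ⊆
      Finset.univ.filter fun p => view H inp t p = z.prev := by
  intro p hp
  simp only [Finset.mem_filter, Finset.mem_univ, true_and] at hp ⊢
  rw [← hp, prev_view]

theorem anonymity_le_prev {t : ℕ} (z : View I (t + 1)) :
    anonymity H inp (t + 1) z ≤ anonymity H inp t z.prev :=
  Finset.card_le_card (anonymity_prev_filter H inp z)

/-- Only an inequality, since `z` may be the view of just part of the class of `z.prev`. It serves
for the second network, where classes may split. -/
theorem mul_count_le_linkCount {t : ℕ} (z : View I (t + 1)) (y : View I t) :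
    anonymity H inp (t + 1) z * z.heard.count y ≤ linkCount H inp t z.prev y := by
  rw [linkCount_eq_sum_count, anonymity, ← smul_eq_mul, ← Finset.sum_const]
  refine le_trans (Finset.sum_le_sum fun p hp => ?_)
    (Finset.sum_le_sum_of_subset (anonymity_prev_filter H inp z))
  rw [(Finset.mem_filter.1 hp).2]

theorem view_eq_of_anonymity_eq {t : ℕ} {z : View I (t + 1)}
    (hz : anonymity H inp (t + 1) z = anonymity H inp t z.prev) {p : V}
    (hp : view H inp t p = z.prev) : view H inp (t + 1) p = z := by
  have h := Finset.eq_of_subset_of_card_le (anonymity_prev_filter H inp z) hz.ge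
  have : p ∈ Finset.univ.filter fun p => view H inp (t + 1) p = z := by rw [h]; simp [hp]
  simpa using this

/-- If all processes with view `z.prev` go on to have the view `z`, then the links between their
class and another one are determined by `z`. -/
theorem mul_count_eq_linkCount {t : ℕ} {z : View I (t + 1)}
    (hz : anonymity H inp (t + 1) z = anonymity H inp t z.prev) (y : View I t) :
    anonymity H inp t z.prev * z.heard.count y = linkCount H inp t z.prev y := by
  rw [linkCount_eq_sum_count, anonymity, ← smul_eq_mul, ← Finset.sum_const]
  refine Finset.sum_congr rfl fun p hp => ?_
  rw [view_eq_of_anonymity_eq H inp hz (Finset.mem_filter.1 hp).2]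

/-- `S` is arbitrary so that it can consist of views taken from another network. -/
theorem sum_anonymity_children_le (t : ℕ) (S : Finset (View I (t + 1))) (x : View I t) :
    ∑ z ∈ S with z.prev = x, anonymity H inp (t + 1) z ≤ anonymity H inp t x := by
  have h : ((Finset.univ.filter fun p => view H inp t p = x).filter
      fun p => view H inp (t + 1) p ∈ S.filter fun z => z.prev = x).card =
      ∑ z ∈ S with z.prev = x, anonymity H inp (t + 1) z := by
    rw [Finset.card_eq_sum_card_fiberwise (f := view H inp (t + 1))
      (t := S.filter fun z => z.prev = x) (fun p hp => by simp at hp ⊢; tauto)]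
    refine Finset.sum_congr rfl fun z hz => ?_
    rw [anonymity]
    congr 1
    ext p
    simp only [Finset.mem_filter, Finset.mem_univ, true_and] at hz ⊢
    constructor
    · exact fun h => h.2
    · rintro rfl
      exact ⟨⟨hz.2, hz⟩, rfl⟩
  rw [← h]
  exact Finset.card_le_card (Finset.filter_subset _ _)

theorem anonymity_eq_sum_children (t : ℕ) (x : View I t) :
    anonymity H inp t x =
      ∑ z ∈ classes H inp (t + 1) with z.prev = x, anonymity H inp (t + 1) z := by
  refine le_antisymm ?_ (sum_anonymity_children_le H inp t _ x)
  rw [anonymity, Finset.card_eq_sum_card_fiberwise (f := view H inp (t + 1))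
      (t := (classes H inp (t + 1)).filter fun z => z.prev = x)
      (fun p hp => by
        simp only [Finset.coe_filter, Finset.mem_univ, true_and, Set.mem_ofPred_eq] at hp ⊢
        exact ⟨view_mem_classes H inp _ _, hp⟩)]
  refine Finset.sum_le_sum fun z _ => Finset.card_le_card fun p hp => ?_
  simp only [Finset.mem_filter, Finset.mem_univ, true_and] at hp ⊢
  exact hp.2

theorem prev_mem_classes {t : ℕ} {z : View I (t + 1)} (hz : z ∈ classes H inp (t + 1)) :
    z.prev ∈ classes H inp t := by
  obtain ⟨p, rfl⟩ := (mem_classes H inp).1 hz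
  exact view_mem_classes H inp t p

theorem image_prev_classes (t : ℕ) :
    (classes H inp (t + 1)).image View.prev = classes H inp t := by
  rw [classes, Finset.image_image]
  rfl

theorem card_classes_le_succ (t : ℕ) :
    (classes H inp t).card ≤ (classes H inp (t + 1)).card := by
  rw [← image_prev_classes]
  exact Finset.card_image_le

theorem card_classes_le (t : ℕ) : (classes H inp t).card ≤ Fintype.card V :=
  Finset.card_image_le

theorem prev_injOn_of_card_le {t : ℕ}
    (h : (classes H inp (t + 1)).card ≤ (classes H inp t).card) :
    Set.InjOn View.prev (classes H inp (t + 1) : Set (View I (t + 1))) := by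
  apply Finset.card_image_iff.1
  rw [image_prev_classes]
  exact le_antisymm (card_classes_le_succ H inp t) h

theorem anonymity_eq_prev_of_injOn {t : ℕ}
    (h : Set.InjOn View.prev (classes H inp (t + 1) : Set (View I (t + 1))))
    {z : View I (t + 1)} (hz : z ∈ classes H inp (t + 1)) :
    anonymity H inp (t + 1) z = anonymity H inp t z.prev := by
  refine le_antisymm (anonymity_le_prev H inp z) (Finset.card_le_card fun p hp => ?_)
  simp only [Finset.mem_filter, Finset.mem_univ, true_and] at hp ⊢
  exact h (view_mem_classes H inp _ p) hz hp

/-! ### Two networks -/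

theorem view_mem_classes_of_succ {t : ℕ} {p : V}
    (h : view H inp (t + 1) p ∈ classes H' inp' (t + 1)) :
    view H inp t p ∈ classes H' inp' t :=
  prev_mem_classes H' inp' h

theorem view_mem_classes_of_link {t : ℕ} {p q : V}
    (h : view H inp (t + 1) p ∈ classes H' inp' (t + 1)) (hq : 0 < H t s(p, q)) :
    view H inp t q ∈ classes H' inp' t := by
  obtain ⟨p', hp'⟩ := (mem_classes H' inp').1 h
  have : view H inp t q ∈ (view H inp (t + 1) p).heard := (mem_heard_view H inp).2 ⟨q, rfl, hq⟩
  rw [← hp'] at this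
  obtain ⟨q', h', -⟩ := (mem_heard_view H' inp').1 this
  exact (mem_classes H' inp').2 ⟨q', h'⟩

/-- A view after `t` rounds in a connected network with `n` processes holds all views of the
rounds up to `t + 1 - n`. -/
theorem classes_subset_of_view_mem (hH : ∀ i, (H i).IsConnected) {t : ℕ} {p : V}
    (hp : view H inp t p ∈ classes H' inp' t) {s : ℕ} (hs : s + Fintype.card V ≤ t + 1) :
    classes H inp s ⊆ classes H' inp' s := by
  -- Going back in time from round `t`, the set `P` of processes whose view occurs in the second
  -- network gains a process per round until it is everything.
  let P : ℕ → Finset V := fun s => Finset.univ.filter fun q => view H inp s q ∈ classes H' inp' s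
  have mono : ∀ s, P (s + 1) ⊆ P s := fun s q hq => by
    simp only [P, Finset.mem_filter, Finset.mem_univ, true_and] at hq ⊢
    exact view_mem_classes_of_succ H inp H' inp' hq
  have key : ∀ j ≤ t, (P (t - j)).Nonempty ∧
      ((∀ q, q ∈ P (t - j)) ∨ j + 1 ≤ (P (t - j)).card) := by
    intro j
    induction j with
    | zero =>
      intro _
      have : (P t).Nonempty := ⟨p, by simp [P, hp]⟩
      exact ⟨this, Or.inr (Finset.card_pos.2 this)⟩
    | succ j ih =>
      intro hj
      obtain ⟨hne, h⟩ := ih (by omega)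
      have e : t - j = t - (j + 1) + 1 := by omega
      generalize t - (j + 1) = r at e ⊢
      rw [e] at hne h
      refine ⟨hne.mono (mono r), ?_⟩
      rcases h with h | h
      · exact Or.inl fun q => mono r (h q)
      -- If `P` does not grow, it is closed under the links of that round, since a shared view
      -- shares all views it has heard; connectivity makes it everything.
      by_cases heq : P (r + 1) = P r
      · left
        obtain ⟨q₀, h₀⟩ := hne
        refine (hH r).forall_of_closed (mono r h₀) fun p q hp hpq => ?_
        rw [← heq] at hp
        simp only [P, Finset.mem_filter, Finset.mem_univ, true_and] at hp ⊢
        exact view_mem_classes_of_link H inp H' inp' hp hpq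
      · right
        have := Finset.card_lt_card ((mono r).ssubset_of_ne heq)
        omega
  have hpos : 0 < Fintype.card V := Fintype.card_pos_iff.2 ⟨p⟩
  have hall : ∀ q, q ∈ P s := by
    obtain ⟨-, h⟩ := key (t - s) (by omega)
    rw [show t - (t - s) = s by omega] at h
    rcases h with h | h
    · exact h
    · intro q
      have : P s = Finset.univ := Finset.eq_univ_of_card _
        (le_antisymm (Finset.card_le_univ _) (by omega))
      rw [this]
      exact Finset.mem_univ q
  intro x hx
  obtain ⟨q, rfl⟩ := (mem_classes H inp).1 hx
  simpa [P] using hall q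

/-- A measure of how far the second network is known to be no larger than the first one. -/
noncomputable def excess (t : ℕ) : ℕ :=
  ∑ x ∈ classes H inp t, (anonymity H inp t x + 1 - anonymity H' inp' t x)

theorem excess_le {t : ℕ} (h : classes H inp t ⊆ classes H' inp' t) :
    excess H inp H' inp' t ≤ Fintype.card V := by
  rw [← sum_anonymity H inp t]
  refine Finset.sum_le_sum fun x hx => ?_
  obtain ⟨p', hp'⟩ := (mem_classes H' inp').1 (h hx)
  have := anonymity_pos H' inp' p' hp'
  omega

/-- If a class splits into `k ≥ 1` parts, the terms `a + 1` of the parts add up to the old `a + k`,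
while their sizes in the second network add up to at most the old `a'`. Truncation can only increase
the sum of the parts. -/
theorem excess_le_succ (t : ℕ) : excess H inp H' inp' t ≤ excess H inp H' inp' (t + 1) := by
  rw [excess, excess, ← Finset.sum_fiberwise_of_maps_to
    (fun z hz => prev_mem_classes H inp (z := z) hz)]
  refine Finset.sum_le_sum fun x hx => ?_
  have h₁ := anonymity_eq_sum_children H inp t x
  have h₂ := sum_anonymity_children_le H' inp' t (classes H inp (t + 1)) x
  obtain ⟨p, hp⟩ := (mem_classes H inp).1 hx
  have hcard : 1 ≤ ((classes H inp (t + 1)).filter fun z => z.prev = x).card :=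
    Finset.card_pos.2 ⟨view H inp (t + 1) p, by simp [view_mem_classes, hp]⟩
  generalize (classes H inp (t + 1)).filter (fun z => z.prev = x) = S at *
  have h₃ : ∑ z ∈ S, (anonymity H inp (t + 1) z + 1) ≤
      ∑ z ∈ S, ((anonymity H inp (t + 1) z + 1 - anonymity H' inp' (t + 1) z) +
        anonymity H' inp' (t + 1) z) := Finset.sum_le_sum fun z _ => by omega
  rw [Finset.sum_add_distrib, Finset.sum_add_distrib, Finset.sum_const, smul_eq_mul] at h₃
  omega

theorem Multiset.count_le_count_of_countP_eq {α : Type*} {m m' : Multiset α} (P : α → Prop)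
    (h : m ≤ m') (hP : m.countP P = m'.countP P) {x : α} (hx : P x) :
    m'.count x ≤ m.count x := by
  by_contra! hlt
  have hle : x ::ₘ m ≤ m' := by
    rw [Multiset.le_iff_count]
    intro y
    rw [Multiset.count_cons]
    split_ifs with hy
    · subst hy; omega
    · exact Multiset.le_iff_count.1 h y
  have := Multiset.countP_le_of_le P hle
  rw [Multiset.countP_cons_of_pos _ hx] at this
  omega

theorem countP_map_view (P : I → Prop) (t : ℕ) :
    (Finset.univ.val.map (view H inp t)).countP (fun x => P x.root) =
      (Finset.univ.val.map inp).countP P := by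
  simp only [Multiset.countP_map, root_view]

/-- As soon as some process satisfies a property that equally many processes of the two networks
have, some class of the first network is not larger in the second. -/
theorem excess_zero_pos (P : I → Prop) {p : V} (hp : P (inp p))
    (hP : (Finset.univ.val.map inp).countP P = (Finset.univ.val.map inp').countP P) :
    0 < excess H inp H' inp' 0 := by
  by_contra! h
  -- Because of the `+ 1`, a vanishing summand means a strictly larger class in the second network;
  -- equal counts of `P` forbid this for the class of `p`.
  have h0 : ∀ x ∈ classes H inp 0, anonymity H inp 0 x < anonymity H' inp' 0 x := by
    intro x hx
    have := Finset.sum_eq_zero_iff.1 (Nat.le_zero.1 h) x hx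
    omega
  have hle : Finset.univ.val.map (view H inp 0) ≤ Finset.univ.val.map (view H' inp' 0) := by
    rw [Multiset.le_iff_count]
    intro x
    rw [count_map_view, count_map_view]
    by_cases hx : x ∈ classes H inp 0
    · exact (h0 x hx).le
    · have : anonymity H inp 0 x = 0 := by
        rw [anonymity, Finset.card_eq_zero, Finset.filter_eq_empty_iff]
        exact fun q _ hq => hx ((mem_classes H inp).2 ⟨q, hq⟩)
      omega
  have := Multiset.count_le_count_of_countP_eq (fun x : View I 0 => P x.root) hle
    (by rw [countP_map_view, countP_map_view, hP]) (x := view H inp 0 p) (by rwa [root_view])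
  rw [count_map_view, count_map_view] at this
  exact absurd (h0 _ (view_mem_classes H inp 0 p)) (by omega)

/-- In each round in which no class of the first network splits, `excess` grows, unless the two
networks have the same inputs. -/
theorem excess_lt_succ_or_map_eq (hH : ∀ i, (H i).IsConnected) (hH' : ∀ i, (H' i).IsConnected)
    (P : I → Prop) {p : V} (hp : P (inp p))
    (hP : (Finset.univ.val.map inp).countP P = (Finset.univ.val.map inp').countP P) {t : ℕ}
    (hsub : classes H inp (t + 1) ⊆ classes H' inp' (t + 1))
    (hpos : 0 < excess H inp H' inp' t)
    (hinj : Set.InjOn View.prev (classes H inp (t + 1) : Set (View I (t + 1)))) :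
    excess H inp H' inp' t < excess H inp H' inp' (t + 1) ∨
      Finset.univ.val.map inp = Finset.univ.val.map inp' := by
  by_contra! hcon
  obtain ⟨hnlt, hne⟩ := hcon
  apply hne
  have ha : ∀ q, anonymity H inp (t + 1) (view H inp (t + 1) q) =
      anonymity H inp t (view H inp t q) := fun q =>
    anonymity_eq_prev_of_injOn H inp hinj (view_mem_classes H inp _ q)
  have ha' : ∀ q, anonymity H' inp' (t + 1) (view H inp (t + 1) q) ≤
      anonymity H' inp' t (view H inp t q) := fun q => anonymity_le_prev H' inp' _
  -- no summand of `excess` changes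
  have hterm : ∀ q, anonymity H inp t (view H inp t q) + 1
      - anonymity H' inp' (t + 1) (view H inp (t + 1) q) =
      anonymity H inp t (view H inp t q) + 1 - anonymity H' inp' t (view H inp t q) := by
    have hsum : excess H inp H' inp' t = ∑ z ∈ classes H inp (t + 1),
        (anonymity H inp t z.prev + 1 - anonymity H' inp' t z.prev) := by
      rw [excess, ← image_prev_classes, Finset.sum_image hinj]
    have hle : ∀ z ∈ classes H inp (t + 1),
        anonymity H inp t z.prev + 1 - anonymity H' inp' t z.prev ≤
        anonymity H inp (t + 1) z + 1 - anonymity H' inp' (t + 1) z := by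
      intro z hz
      obtain ⟨q, rfl⟩ := (mem_classes H inp).1 hz
      have h1 := ha q
      have h2 := ha' q
      rw [prev_view]
      omega
    have heq := (Finset.sum_eq_sum_iff_of_le hle).1
      (le_antisymm (Finset.sum_le_sum hle) (by rw [← hsum]; exact hnlt))
    intro q
    have := heq _ (view_mem_classes H inp (t + 1) q)
    rw [prev_view, ha q] at this
    exact this.symm
  -- Balance equation in the first network: no class splits, so both sides count the links between
  -- the two classes.
  have hlink : ∀ q r, anonymity H inp t (view H inp t q) *
      (view H inp (t + 1) q).heard.count (view H inp t r) =
      anonymity H inp t (view H inp t r) *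
      (view H inp (t + 1) r).heard.count (view H inp t q) := fun q r => by
    have h1 := mul_count_eq_linkCount H inp (z := view H inp (t + 1) q) (ha q) (view H inp t r)
    have h2 := mul_count_eq_linkCount H inp (z := view H inp (t + 1) r) (ha r) (view H inp t q)
    rw [prev_view] at h1 h2
    rw [h1, h2, linkCount_comm]
  have hcount : ∀ q r, 0 < H t s(q, r) →
      0 < (view H inp (t + 1) r).heard.count (view H inp t q) := fun q r h =>
    Multiset.count_pos.2 ((mem_heard_view H inp).2 ⟨q, rfl, by rwa [Sym2.eq_swap]⟩)
  -- A positive summand that stays constant means that the class of `q` does not split in the second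
  -- network either, so its link count there is exact. Comparing with `hlink` bounds the part of the
  -- class of `r` in the second network that keeps a common view; the summand at `r` is then
  -- positive after the round, hence also before it.
  have hK : ∀ q, anonymity H' inp' t (view H inp t q) ≤ anonymity H inp t (view H inp t q) := by
    obtain ⟨x, hx, hx0⟩ := Finset.exists_ne_zero_of_sum_ne_zero hpos.ne'
    obtain ⟨q₀, rfl⟩ := (mem_classes H inp).1 hx
    refine (hH t).forall_of_closed (p := q₀) (by omega) fun q r hq hqr => ?_
    have hq' : anonymity H' inp' (t + 1) (view H inp (t + 1) q) =
        anonymity H' inp' t (view H inp t q) := by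
      have h1 := hterm q
      have h2 := ha' q
      omega
    have h1 := mul_count_eq_linkCount H' inp' (z := view H inp (t + 1) q) hq' (view H inp t r)
    have h2 := mul_count_le_linkCount H' inp' (view H inp (t + 1) r) (view H inp t q)
    rw [prev_view] at h1 h2
    rw [linkCount_comm, ← h1] at h2
    have h3 := h2.trans (Nat.mul_le_mul_right _ hq)
    rw [hlink] at h3
    have h4 := Nat.le_of_mul_le_mul_right h3 (hcount q r hqr)
    have h5 := hterm r
    omega
  have hnb : ∀ q, anonymity H' inp' (t + 1) (view H inp (t + 1) q) =
      anonymity H' inp' t (view H inp t q) := fun q => by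
    have h1 := hterm q
    have h2 := ha' q
    have h3 := hK q
    omega
  -- Now connectivity of the second network is used: by `hnb` its processes with a common view hear
  -- only common views.
  have hall : ∀ q', view H' inp' t q' ∈ classes H inp t := by
    obtain ⟨q', hq'⟩ := (mem_classes H' inp').1 (hsub (view_mem_classes H inp (t + 1) p))
    have hq₀ : view H' inp' t q' ∈ classes H inp t := by
      rw [← prev_view, hq']
      exact view_mem_classes H inp t p
    refine (hH' t).forall_of_closed hq₀ fun q' r' hq' hqr => ?_
    obtain ⟨q, hq⟩ := (mem_classes H inp).1 hq'
    refine view_mem_classes_of_link H' inp' H inp (p := q') ?_ hqr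
    rw [view_eq_of_anonymity_eq H' inp' (z := view H inp (t + 1) q) (hnb q) hq.symm]
    exact view_mem_classes H inp _ q
  have hle : Finset.univ.val.map (view H' inp' t) ≤ Finset.univ.val.map (view H inp t) := by
    rw [Multiset.le_iff_count]
    intro x
    rw [count_map_view, count_map_view]
    by_cases hx : x ∈ classes H inp t
    · obtain ⟨q, rfl⟩ := (mem_classes H inp).1 hx
      exact hK q
    · have : anonymity H' inp' t x = 0 := by
        rw [anonymity, Finset.card_eq_zero, Finset.filter_eq_empty_iff]
        exact fun q' _ hq => hx (hq ▸ hall q')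
      omega
  -- Inclusion of multisets together with equal counts of `P` gives the bound at `p`; balance
  -- equations, now exact in both networks, carry it along links.
  have hge : ∀ q, anonymity H inp t (view H inp t q) ≤ anonymity H' inp' t (view H inp t q) := by
    refine (hH t).forall_of_closed (p := p) ?_ fun q r hq hqr => ?_
    · rw [← count_map_view, ← count_map_view]
      exact Multiset.count_le_count_of_countP_eq (fun x : View I t => P x.root) hle
        (by rw [countP_map_view, countP_map_view, hP]) (by rwa [root_view])
    · have h1 := mul_count_eq_linkCount H' inp' (z := view H inp (t + 1) q) (hnb q)
        (view H inp t r)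
      have h2 := mul_count_eq_linkCount H' inp' (z := view H inp (t + 1) r) (hnb r)
        (view H inp t q)
      rw [prev_view] at h1 h2
      rw [linkCount_comm, ← h1] at h2
      have h3 := Nat.mul_le_mul_right
        ((view H inp (t + 1) q).heard.count (view H inp t r)) hq
      rw [hlink, ← h2] at h3
      exact Nat.le_of_mul_le_mul_right h3 (hcount q r hqr)
  have hmap : Finset.univ.val.map (view H inp t) = Finset.univ.val.map (view H' inp' t) := by
    refine le_antisymm ?_ hle
    rw [Multiset.le_iff_count]
    intro x
    rw [count_map_view, count_map_view]
    by_cases hx : x ∈ classes H inp t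
    · obtain ⟨q, rfl⟩ := (mem_classes H inp).1 hx
      exact hge q
    · have : anonymity H inp t x = 0 := by
        rw [anonymity, Finset.card_eq_zero, Finset.filter_eq_empty_iff]
        exact fun q _ hq => hx ((mem_classes H inp).2 ⟨q, hq⟩)
      omega
  have := congrArg (Multiset.map View.root) hmap
  simpa only [Multiset.map_map, Function.comp_def, root_view] using this

/-- The view of a process after `3 n` rounds in a connected network with `n` processes determines
the multiset of all inputs, given the number of leaders. -/
theorem map_eq_of_view_eq (hH : ∀ i, (H i).IsConnected) (hH' : ∀ i, (H' i).IsConnected)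
    (P : I → Prop) (hpos : 0 < (Finset.univ.val.map inp).countP P)
    (hP : (Finset.univ.val.map inp).countP P = (Finset.univ.val.map inp').countP P) {t : ℕ}
    (ht : 3 * Fintype.card V ≤ t) {p : V} {p' : V'}
    (hp : view H inp t p = view H' inp' t p') :
    Finset.univ.val.map inp = Finset.univ.val.map inp' := by
  by_contra hne
  obtain ⟨y, hy, hPy⟩ := Multiset.countP_pos.1 hpos
  obtain ⟨r, -, rfl⟩ := Multiset.mem_map.1 hy
  have hsub : ∀ s, s + Fintype.card V ≤ t + 1 → classes H inp s ⊆ classes H' inp' s := fun s hs =>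
    classes_subset_of_view_mem H inp H' inp' hH (p := p)
      (by rw [hp]; exact view_mem_classes H' inp' t p') hs
  have hgrow : ∀ s, s + Fintype.card V ≤ t + 1 → 0 < excess H inp H' inp' s ∧
      s + 1 ≤ (classes H inp s).card + excess H inp H' inp' s := by
    intro s
    induction s with
    | zero =>
      intro _
      have := excess_zero_pos H inp H' inp' P hPy hP
      exact ⟨this, by omega⟩
    | succ s ih =>
      intro hs
      obtain ⟨h1, h2⟩ := ih (by omega)
      have h3 := excess_le_succ H inp H' inp' s
      have h4 := card_classes_le_succ H inp s
      refine ⟨by omega, ?_⟩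
      by_cases hc : (classes H inp (s + 1)).card ≤ (classes H inp s).card
      · rcases excess_lt_succ_or_map_eq H inp H' inp' hH hH' P hPy hP (hsub _ hs) h1
          (prev_injOn_of_card_le H inp hc) with h | h
        · omega
        · exact absurd h hne
      · omega
  -- At round `2 * n` the sum is at least `2 * n + 1`, but both terms are at most `n`.
  have h1 := (hgrow (2 * Fintype.card V) (by omega)).2
  have h2 := card_classes_le H inp (2 * Fintype.card V)
  have h3 := excess_le H inp H' inp' (hsub (2 * Fintype.card V) (by omega))
  omega

end Network

/-! ### Certificates and the algorithm -/

section Algorithm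

open scoped Classical

variable {X : Type u}

theorem countP_map_leader {V : Type} [Fintype V] (inp : V → Bool × X)
    [DecidablePred fun x : Bool × X => x.1 = true] :
    (Finset.univ.val.map inp).countP (fun x => x.1 = true) = numLeaders inp := by
  rw [Multiset.countP_map, numLeaders, Finset.card_def, Finset.filter_val]
  congr!

/-- The view `x` after `t` rounds occurs in a connected dynamic network with `ℓ` leaders, with at
most `t / 3` processes, in which the multiset of inputs is `μ`. -/
def IsCertified (ℓ t : ℕ) (x : View (Bool × X) t) (μ : Multiset (Bool × X)) : Prop :=
  ∃ (n : ℕ) (H : ℕ → Multigraph (Fin n)) (inp : Fin n → Bool × X) (p : Fin n),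
    (∀ i, (H i).IsConnected) ∧ numLeaders inp = ℓ ∧ 3 * n ≤ t ∧ view H inp t p = x ∧
      Finset.univ.val.map inp = μ

/-- The certifying network takes the role of the first network in `map_eq_of_view_eq`, so its own
size bound suffices and nothing is assumed about `n`. Equal multisets then force equal sizes, so no
certificate can appear before round `3 * n`. -/
theorem IsCertified.eq_and_le {ℓ t n : ℕ} (hℓ : 1 ≤ ℓ) {H : ℕ → Multigraph (Fin n)}
    {inp : Fin n → Bool × X} (hH : ∀ i, (H i).IsConnected) (hinp : numLeaders inp = ℓ)
    {p : Fin n} {μ : Multiset (Bool × X)} (h : IsCertified ℓ t (view H inp t p) μ) :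
    μ = Finset.univ.val.map inp ∧ 3 * n ≤ t := by
  obtain ⟨n', H', inp', p', hH', hinp', hn', hp', rfl⟩ := h
  have hμ := map_eq_of_view_eq H' inp' H inp hH' hH (fun x => x.1 = true)
    (by rw [countP_map_leader, hinp']; exact hℓ)
    (by rw [countP_map_leader, countP_map_leader, hinp, hinp']) (by simpa using hn') hp'
  have hcard := congrArg Multiset.card hμ
  simp only [Multiset.card_map, Finset.card_val, Finset.card_univ, Fintype.card_fin] at hcard
  exact ⟨hμ, by omega⟩

/-- The state of a process in a block of `T` rounds: its view at the beginning of the block, the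
number of rounds of the block that have passed, and the views received in them; or else its
output. -/
abbrev BlockState (I : Type u) : Type u :=
  (Σ t : ℕ, View I t × ℕ × Multiset (View I t)) ⊕ Multiset I

/-- The view that a message holds, if it is one after `t` blocks. -/
noncomputable def BlockState.payload {I : Type u} (t : ℕ) : BlockState I → Multiset (View I t)
  | Sum.inl ⟨s, x, _⟩ => if h : s = t then {h ▸ x} else 0
  | Sum.inr _ => 0

/-- A process sends its view at the beginning of each block in every round of the block, and
outputs a multiset of inputs as soon as its view certifies it. -/
noncomputable def blockAlgorithm (X : Type u) (ℓ T : ℕ) :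
    LocalAlgorithm (Bool × X) (Multiset (Bool × X)) where
  State := BlockState (Bool × X)
  terminal := Set.range Sum.inr
  init x := Sum.inl ⟨0, x, 0, 0⟩
  output s := s.2.choose
  step s M :=
    match s.1 with
    | Sum.inr μ => Sum.inr μ
    | Sum.inl ⟨t, x, c, R⟩ =>
      let R' := R + (M.map (BlockState.payload t)).sum
      if c + 1 < T then Sum.inl ⟨t, x, c + 1, R'⟩
      else
        let y : View (Bool × X) (t + 1) := (x, R')
        -- The choice is harmless: in an actual execution `IsCertified.eq_and_le` leaves only one
        -- possible `μ`.
        if h : ∃ μ, IsCertified ℓ (t + 1) y μ then Sum.inr h.choose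
        else Sum.inl ⟨t + 1, y, 0, 0⟩

theorem blockAlgorithm_update_inl (ℓ T t c : ℕ) (x : View (Bool × X) t)
    (R : Multiset (View (Bool × X) t)) (M : Multiset (BlockState (Bool × X))) :
    (blockAlgorithm X ℓ T).update (Sum.inl ⟨t, x, c, R⟩) M =
      if c + 1 < T then Sum.inl ⟨t, x, c + 1, R + (M.map (BlockState.payload t)).sum⟩
      else if h : ∃ μ, IsCertified (X := X) ℓ (t + 1)
          (x, R + (M.map (BlockState.payload t)).sum) μ then Sum.inr h.choose
      else Sum.inl ⟨t + 1, (x, R + (M.map (BlockState.payload t)).sum), 0, 0⟩ := by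
  have hterm : (Sum.inl ⟨t, x, c, R⟩ : BlockState (Bool × X)) ∉
      (blockAlgorithm X ℓ T).terminal := by
    rintro ⟨μ, hμ⟩
    cases hμ
  exact dif_neg hterm

theorem sum_map_received {V : Type} [Fintype V] {I O : Type u} {α : Type*} [AddCommMonoid α]
    (A : LocalAlgorithm I O) (E : Multigraph V) (σ : V → A.State) (p : V) (f : A.State → α) :
    ((A.received E σ p).map f).sum = ∑ q, E s(p, q) • f (σ q) := by
  have h : ∀ M : Multiset A.State, (M.map f).sum =
      (Multiset.sumAddMonoidHom.comp (Multiset.mapAddMonoidHom f)) M := fun _ => rfl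
  rw [h, LocalAlgorithm.received, map_sum]
  refine Finset.sum_congr rfl fun q _ => ?_
  rw [map_nsmul]
  simp

/-! ### Simulation of one exchange of views by a block of rounds -/

/-- The links of the rounds of each block of length `T`, taken together. -/
def DynamicNetwork.blocks {V : Type} (G : DynamicNetwork V) (T i : ℕ) : Multigraph V :=
  fun e => ∑ t ∈ Finset.Ico (i * T + 1) (i * T + 1 + T), G t e

theorem DynamicNetwork.blocks_apply {V : Type} (G : DynamicNetwork V) (T i : ℕ) (e : Sym2 V) :
    G.blocks T i e = ∑ r ∈ Finset.range T, G (i * T + 1 + r) e := by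
  rw [DynamicNetwork.blocks, Finset.sum_Ico_eq_sum_range, Nat.add_sub_cancel_left]

variable {n : ℕ} {G : DynamicNetwork (Fin n)} {inp : Fin n → Bool × X} {ℓ T : ℕ}

/-- The views received in the first `c` rounds of a block. -/
def blockReceived (G : DynamicNetwork (Fin n)) (inp : Fin n → Bool × X) (T i c : ℕ) (p : Fin n) :
    Multiset (View (Bool × X) i) :=
  ∑ r ∈ Finset.range c, ∑ q, G (i * T + 1 + r) s(p, q) • {view (G.blocks T) inp i q}

theorem view_blocks_succ (i : ℕ) (p : Fin n) :
    view (G.blocks T) inp (i + 1) p =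
      (view (G.blocks T) inp i p, blockReceived G inp T i T p) := by
  rw [view, blockReceived, Finset.sum_comm]
  congr 1
  refine Finset.sum_congr rfl fun q _ => ?_
  rw [DynamicNetwork.blocks_apply, Finset.sum_smul]

/-- The effect of one round on states that hold the views of the current block. -/
theorem run_succ_of_run_eq {i c : ℕ} (h : ∀ p, (blockAlgorithm X ℓ T).run G inp (i * T + c) p =
      Sum.inl ⟨i, view (G.blocks T) inp i p, c, blockReceived G inp T i c p⟩) (p : Fin n) :
    (blockAlgorithm X ℓ T).run G inp (i * T + c + 1) p =
      if c + 1 < T then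
        Sum.inl ⟨i, view (G.blocks T) inp i p, c + 1, blockReceived G inp T i (c + 1) p⟩
      else if h : ∃ μ, IsCertified (X := X) ℓ (i + 1)
          (view (G.blocks T) inp i p, blockReceived G inp T i (c + 1) p) μ then Sum.inr h.choose
      else Sum.inl
        ⟨i + 1, (view (G.blocks T) inp i p, blockReceived G inp T i (c + 1) p), 0, 0⟩ := by
  have hR : blockReceived G inp T i c p +
      (((blockAlgorithm X ℓ T).received (G (i * T + c + 1))
        ((blockAlgorithm X ℓ T).run G inp (i * T + c)) p).map (BlockState.payload i)).sum =
      blockReceived G inp T i (c + 1) p := by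
    rw [blockReceived, blockReceived, Finset.sum_range_succ]
    refine congrArg _ ((sum_map_received (blockAlgorithm X ℓ T) _ _ p
      (BlockState.payload i)).trans ?_)
    refine Finset.sum_congr rfl fun q _ => ?_
    rw [h q, Nat.add_right_comm]
    simp [BlockState.payload]
  rw [LocalAlgorithm.run, h p, ← hR]
  exact blockAlgorithm_update_inl ℓ T i c _ _ _

/-- No process can stop before the end of block number `3 * n`, so every message up to then carries
a view; a process that stopped early would contribute nothing to its neighbors. -/
theorem run_blockAlgorithm_eq (hℓ : 1 ≤ ℓ) (hT : 1 ≤ T)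
    (hG : ∀ i, (G.blocks T i).IsConnected) (hinp : numLeaders inp = ℓ) (i : ℕ) (hi : i < 3 * n)
    (c : ℕ) (hc : c < T) (p : Fin n) :
    (blockAlgorithm X ℓ T).run G inp (i * T + c) p =
      Sum.inl ⟨i, view (G.blocks T) inp i p, c, blockReceived G inp T i c p⟩ := by
  induction i generalizing c p with
  | zero =>
    induction c generalizing p with
    | zero => rw [Nat.zero_mul]; rfl
    | succ c ih => exact (run_succ_of_run_eq (ih (by omega)) p).trans (if_pos hc)
  | succ i ihi =>
    induction c generalizing p with
    | zero =>
      have h := run_succ_of_run_eq (fun p => ihi (by omega) (T - 1) (by omega) p) p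
      rw [if_neg (by omega), show T - 1 + 1 = T by omega, ← view_blocks_succ,
        dif_neg fun ⟨μ, hμ⟩ => by
          have := (hμ.eq_and_le hℓ hG hinp).2
          omega] at h
      rw [show (i + 1) * T + 0 = i * T + (T - 1) + 1 by rw [Nat.add_mul]; omega, h]
      rfl
    | succ c ih => exact (run_succ_of_run_eq (ih (by omega)) p).trans (if_pos hc)

theorem run_blockAlgorithm_final (hℓ : 1 ≤ ℓ) (hT : 1 ≤ T)
    (hG : ∀ i, (G.blocks T i).IsConnected) (hinp : numLeaders inp = ℓ) (p : Fin n) :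
    (blockAlgorithm X ℓ T).run G inp (3 * n * T) p = Sum.inr (Finset.univ.val.map inp) := by
  have hn : 0 < n := p.pos
  obtain ⟨i, hi⟩ : ∃ i, 3 * n = i + 1 := ⟨3 * n - 1, by omega⟩
  have h := run_succ_of_run_eq
    (fun p => run_blockAlgorithm_eq hℓ hT hG hinp i (by omega) (T - 1) (by omega) p) p
  -- The network of blocks certifies its own views after `3 * n` blocks, so all processes stop
  -- simultaneously.
  have hex : ∃ μ, IsCertified ℓ (i + 1) (view (G.blocks T) inp (i + 1) p) μ :=
    ⟨_, n, G.blocks T, inp, p, hG, hinp, hi.le, rfl, rfl⟩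
  rw [if_neg (by omega), show T - 1 + 1 = T by omega, ← view_blocks_succ, dif_pos hex] at h
  rw [hi, show (i + 1) * T = i * T + (T - 1) + 1 by rw [Nat.add_mul]; omega, h]
  exact congrArg Sum.inr (hex.choose_spec.eq_and_le hℓ hG hinp).1

end Algorithm

theorem theoremt {X : Type u} (ℓ T : ℕ) (hℓ : 1 ≤ ℓ) (hT : 1 ≤ T) :
    ∃ A : LocalAlgorithm (Bool × X) (Multiset (Bool × X)),
      ∀ (n : ℕ) (G : DynamicNetwork (Fin n)) (inp : Fin n → Bool × X),
        G.IsIntervalDisconnected T → numLeaders inp = ℓ →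
          A.TerminatesWithin G inp ((ℓ ^ 2 + ℓ + 1) * T * n) (generalizedCounting inp) := by
  refine ⟨blockAlgorithm X ℓ T, fun n G inp hG hinp => ⟨3 * n * T, ?_, ?_⟩⟩
  · have : 3 ≤ ℓ ^ 2 + ℓ + 1 := by nlinarith
    calc 3 * n * T = 3 * (T * n) := by ring
      _ ≤ (ℓ ^ 2 + ℓ + 1) * (T * n) := Nat.mul_le_mul_right _ this
      _ = (ℓ ^ 2 + ℓ + 1) * T * n := by ring
  -- Block `i` is the window of `T` rounds that starts at `i * T + 1`, hence connected.
  · have hrun := fun p => run_blockAlgorithm_final hℓ hT (p := p)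
      (fun i => hG (i * T + 1) (by omega)) hinp
    have hterm : ∀ p, (blockAlgorithm X ℓ T).run G inp (3 * n * T) p ∈
        (blockAlgorithm X ℓ T).terminal := fun p => ⟨_, (hrun p).symm⟩
    exact ⟨hterm, fun p => Sum.inr_injective ((hterm p).choose_spec.trans (hrun p))⟩
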